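/- Let $S\neq\{0\}$ be a countable abelian group with a metric inducing the discrete topology, and let $X=(X_t)_{t\ge 0}$ be an irreducible continuous-time random walk on $S$ started in $0$, i.e. a L\'evy process with c\`adl\`ag paths, $X_0=0$ and independent stationary increments, such that the transition probabilities $p_t(x,y)=\mathbb P[x+X_t=y]$ satisfy: for all $x,y\in S$ there is $t>0$ with $p_t(x,y)>0$. Let $$H=\inf\{t>0: X_t\neq 0\},\qquad T=\inf\{t>H: X_t=0\}\in[0,\infty]$$ be the holding time and the first return time to the origin (with $\inf\emptyset=\infty$). Let $T_t\varphi(x)=\mathbb E\,\varphi(x+X_t)$ and $G^{\zeta}\varphi=\frac1{\Gamma(\zeta)}\int_0^\infty t^{\zeta-1}T_t\varphi\,dt$ for $\zeta>0$, and define the degree of $X$ by $$\gamma=\sup\{\zeta>-1:\ G^{\zeta+1}\varphi<\infty\text{ for all bounded measurable }\varphi\ge 0\text{ with bounded support}\}\in[-\infty,\infty].$$ Let $\mu\in(0,1)$ and suppose that $p_t(0,0)^{-1}=o(t^{\mu+\varepsilon})$ as $t\to\infty$ for all $\varepsilon>0$. (In particular $X$ is then recurrent, i.e. $\int_0^\infty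 p_t(0,0)\,dt=\infty$.) Then $\gamma\le\mu-1$, and $T$ is a random variable (up to null sets) with $\mathbb E[T^{\zeta}]<\infty$ for every $\zeta\in(0,1-\mu)$; in particular $T<\infty$ almost surely. -/

import Mathlib

open MeasureTheory ProbabilityTheory Filter Topology Asymptotics
open scoped NNReal ENNReal

noncomputable section

namespace LevyWalk

variable {S Ω : Type*} [AddCommGroup S] [MeasurableSpace Ω]

/-- `X` is a Lévy process with càdlàg paths started at the origin of the abelian group `S`: it starts
almost surely in `0`, has independent and stationary increments, and almost all of its paths are
right continuous with left limits. For countable discrete `S` this is a random walk on `S` in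
continuous time. -/
structure IsLevyProcess [TopologicalSpace S] [MeasurableSpace S]
    (X : ℝ≥0 → Ω → S) (P : Measure Ω) : Prop where
  measurable : ∀ t, Measurable (X t)
  start : ∀ᵐ ω ∂P, X 0 ω = 0
  indep : HasIndepIncrements X P
  stationary : ∀ s h : ℝ≥0,
    IdentDistrib (fun ω => X (s + h) ω - X s ω) (fun ω => X h ω - X 0 ω) P P
  cadlag : ∀ᵐ ω ∂P, ∀ t : ℝ≥0,
    ContinuousWithinAt (fun s => X s ω) (Set.Ici t) t ∧
      ∃ x : S, Tendsto (fun s => X s ω) (𝓝[<] t) (𝓝 x)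

/-- The transition probability `p_t(x, y)`: the probability that the process `x + X`, which starts
in `x`, is in `y` at time `t`. -/
def transProb (X : ℝ≥0 → Ω → S) (P : Measure Ω) (t : ℝ≥0) (x y : S) : ℝ :=
  P.real {ω | x + X t ω = y}

/-- Every state is reached from every state with positive probability. -/
def IsIrreducible (X : ℝ≥0 → Ω → S) (P : Measure Ω) : Prop :=
  ∀ x y : S, ∃ t : ℝ≥0, 0 < t ∧ 0 < transProb X P t x y

/-- The holding time `H = inf {t > 0 : X_t ≠ 0}`, with `inf ∅ = ∞`. -/
def holdingTime (X : ℝ≥0 → Ω → S) (ω : Ω) : ℝ≥0∞ :=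
  ⨅ (t : ℝ≥0) (_ : 0 < t ∧ X t ω ≠ 0), (t : ℝ≥0∞)

/-- The first return time `T = inf {t > H : X_t = 0}` to the origin, with `inf ∅ = ∞`. -/
def returnTime (X : ℝ≥0 → Ω → S) (ω : Ω) : ℝ≥0∞ :=
  ⨅ (t : ℝ≥0) (_ : holdingTime X ω < t ∧ X t ω = 0), (t : ℝ≥0∞)

/-- The semigroup `T_t φ (x) = E_x φ(X_t)` on nonnegative functions. -/
def semigroup (X : ℝ≥0 → Ω → S) (P : Measure Ω) (t : ℝ≥0) (φ : S → ℝ≥0) (x : S) : ℝ≥0∞ :=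
  ∫⁻ ω, (φ (x + X t ω) : ℝ≥0∞) ∂P

/-- The power `G^ζ φ (x) = Γ(ζ)⁻¹ ∫₀^∞ t^(ζ-1) T_t φ (x) dt` of the Green operator, for `ζ > 0`, on
nonnegative functions. -/
def greenPower (X : ℝ≥0 → Ω → S) (P : Measure Ω) (ζ : ℝ) (φ : S → ℝ≥0) (x : S) : ℝ≥0∞ :=
  ENNReal.ofReal (Real.Gamma ζ)⁻¹ *
    ∫⁻ t in Set.Ioi (0 : ℝ), ENNReal.ofReal (t ^ (ζ - 1)) * semigroup X P t.toNNReal φ x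

/-- The degree of `X`: the supremum (in `[-∞, ∞]`) of the `ζ > -1` such that `G^(ζ+1) φ < ∞` for all
bounded measurable nonnegative functions `φ` with bounded support. -/
def degree [MetricSpace S] [MeasurableSpace S] (X : ℝ≥0 → Ω → S) (P : Measure Ω) : EReal :=
  sSup ((fun ζ : ℝ => (ζ : EReal)) '' {ζ : ℝ | -1 < ζ ∧
    ∀ φ : S → ℝ≥0, Measurable φ → BddAbove (Set.range φ) →
      Bornology.IsBounded (Function.support φ) → ∀ x : S, greenPower X P (ζ + 1) φ x < ∞})

end LevyWalk

end

/-! The hypothesis gives `p_t(0,0) ≥ t ^ (-a)` for large `t`, for every `a > μ`. Both conclusions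
rest on this bound.

Degree: `t ^ (a - 1) * p_t(0,0) ≥ t⁻¹` near infinity, so the Green power of order `a` of the
indicator of the origin is infinite at `0` (`greenPower_single_eq_top`); no `ζ > μ - 1` is
admissible.

Return time: sampling at a mesh `δ` with `p_δ(0,0) < 1` gives a random walk with i.i.d. increments.
Let `r n` be its probability of avoiding the origin during steps `1, ..., n`. A last exit argument
(`sum_mul_avoidProb_le_one`) gives `r n * ∑_{k ≤ n} p_{kδ}(0,0) ≤ 1`, hence `r n = O(n ^ (a - 1))`.
The walk must first leave the origin, which costs a geometric delay, so the tail of its return time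
is bounded by a convolution of a geometric sequence with `r` (`measure_noReturn_le`). Summing
against `(n + 1) ^ (ζ - 1)` converges when `ζ + a < 1`. A return of the sampled walk is a return of
`X`, so `T` inherits the moments (`returnTime_rpow_le`). -/

namespace LevyWalk

/-! ### Discrete-time random walks: tail of the first return time. -/

section RandomWalk

variable {S Ω : Type*} [MeasurableSpace S] [MeasurableSpace Ω] {P : Measure Ω} {ξ : ℕ → Ω → S}

/-- The past `(ξ i)_{i < k}` of an independent sequence is independent of its future. -/
lemma indepFun_past_future (hm : ∀ i, Measurable (ξ i)) (hi : iIndepFun ξ P) (k : ℕ) :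
    IndepFun (fun ω (i : Fin k) => ξ i ω) (fun ω (i : ℕ) => ξ (k + i) ω) P := by
  have := hi.isProbabilityMeasure
  refine IndepFun.process_indepFun_process (X := fun (i : Fin k) ω => ξ i ω)
    (Y := fun (i : ℕ) ω => ξ (k + i) ω) (fun i => hm _) (fun i => hm _) fun I J => ?_
  have hd : Disjoint (Finset.range k) (J.map (addLeftEmbedding k)) := by
    rw [Finset.disjoint_left]
    intro a ha hb
    simp only [Finset.mem_range, Finset.mem_map, addLeftEmbedding_apply] at ha hb
    obtain ⟨b, -, rfl⟩ := hb
    omega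
  have h := hi.indepFun_finset _ _ hd hm
  have h' := h.comp
    (φ := fun x (i : I) => x ⟨(i : Fin k), Finset.mem_range.2 i.1.2⟩)
    (ψ := fun x (j : J) => x ⟨k + j, by simp⟩)
    (measurable_pi_lambda _ fun i => measurable_pi_apply _)
    (measurable_pi_lambda _ fun i => measurable_pi_apply _)
  exact h'

/-- The Markov property of an independent and identically distributed sequence. -/
lemma measure_past_future (hm : ∀ i, Measurable (ξ i)) (hi : iIndepFun ξ P)
    (hid : ∀ i, IdentDistrib (ξ i) (ξ 0) P P) (k : ℕ)
    {B : Set (Fin k → S)} (hB : MeasurableSet B) {C : Set (ℕ → S)} (hC : MeasurableSet C) :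
    P {ω | (fun i : Fin k => ξ i ω) ∈ B ∧ (fun i : ℕ => ξ (k + i) ω) ∈ C} =
      P {ω | (fun i : Fin k => ξ i ω) ∈ B} * P {ω | (fun i : ℕ => ξ i ω) ∈ C} := by
  have := hi.isProbabilityMeasure
  have h := (indepFun_past_future hm hi k).measure_inter_preimage_eq_mul B C hB hC
  have hshift : iIndepFun (fun i : ℕ => ξ (k + i)) P :=
    hi.precomp (g := fun i => k + i) (add_right_injective k)
  have hlaw : P.map (fun ω (i : ℕ) => ξ (k + i) ω) = P.map (fun ω (i : ℕ) => ξ i ω) := by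
    rw [hshift.map_fun_eq_infinitePi_map fun i => hm _, hi.map_fun_eq_infinitePi_map hm]
    congr 1
    funext i
    exact (hid _).map_eq.trans (hid _).map_eq.symm
  have h2 : P ((fun ω (i : ℕ) => ξ (k + i) ω) ⁻¹' C) = P ((fun ω (i : ℕ) => ξ i ω) ⁻¹' C) := by
    rw [← Measure.map_apply (measurable_pi_lambda _ fun i => hm _) hC, hlaw,
      Measure.map_apply (measurable_pi_lambda _ fun i => hm _) hC]
  rw [h2] at h
  exact h

variable [AddCommGroup S] [DiscreteMeasurableSpace S]

lemma measure_zero_prefix (hi : iIndepFun ξ P)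
    (hid : ∀ i, IdentDistrib (ξ i) (ξ 0) P P) (k : ℕ) :
    P {ω | ∀ i : Fin k, ξ i ω = 0} = P {ω | ξ 0 ω = 0} ^ k := by
  have := hi.isProbabilityMeasure
  have h := hi.measure_inter_preimage_eq_mul (Finset.range k) (sets := fun _ => {0})
    fun i _ => MeasurableSet.of_discrete
  have h1 : {ω | ∀ i : Fin k, ξ i ω = 0} = ⋂ i ∈ Finset.range k, ξ i ⁻¹' {0} := by
    ext ω
    simp [Fin.forall_iff]
  rw [h1, h, Finset.prod_congr rfl fun i _ => (hid i).measure_mem_eq MeasurableSet.of_discrete]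
  simp
  rfl

variable [Countable S]

/-- The set of sequences whose first `m` partial sums do not vanish. -/
def avoidSet (S : Type*) [AddCommGroup S] (m : ℕ) : Set (ℕ → S) :=
  {x | ∀ j, 0 < j → j ≤ m → ∑ i ∈ Finset.range j, x i ≠ 0}

lemma measurableSet_avoidSet (m : ℕ) : MeasurableSet (avoidSet S m) := by
  have : avoidSet S m = ⋂ (j : ℕ) (_ : 0 < j) (_ : j ≤ m),
      (fun x : ℕ → S => ∑ i ∈ Finset.range j, x i) ⁻¹' {0}ᶜ := by
    ext x
    simp [avoidSet]
  rw [this]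
  refine MeasurableSet.iInter fun j => MeasurableSet.iInter fun _ => MeasurableSet.iInter fun _ => ?_
  exact (Finset.measurable_sum _ fun i _ => measurable_pi_apply i) (MeasurableSet.of_discrete)

/-- Probability that a random walk with increments `ξ` avoids the origin up to time `m`. -/
def avoidProb (P : Measure Ω) (ξ : ℕ → Ω → S) (m : ℕ) : ℝ≥0∞ :=
  P {ω | (fun i => ξ i ω) ∈ avoidSet S m}

/-- Last exit decomposition. -/
lemma sum_mul_avoidProb_le_one (hm : ∀ i, Measurable (ξ i)) (hi : iIndepFun ξ P)
    (hid : ∀ i, IdentDistrib (ξ i) (ξ 0) P P) (n : ℕ) :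
    (∑ k ∈ Finset.range (n + 1), P {ω | ∑ i ∈ Finset.range k, ξ i ω = 0}) * avoidProb P ξ n ≤ 1 := by
  have := hi.isProbabilityMeasure
  -- Avoidance is required for `n` further steps whatever `k` is: this makes the second factor
  -- independent of `k` and still excludes every later zero up to time `n`.
  let E : ℕ → Set Ω := fun k => {ω | (fun i : Fin k => ξ i ω) ∈ {x : Fin k → S | ∑ i, x i = 0} ∧
    (fun i : ℕ => ξ (k + i) ω) ∈ avoidSet S n}
  have hB : ∀ k, MeasurableSet {x : Fin k → S | ∑ i, x i = 0} := fun k =>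
    (Finset.measurable_sum (f := fun (i : Fin k) (x : Fin k → S) => x i) Finset.univ
      fun i _ => measurable_pi_apply i) (MeasurableSet.of_discrete (s := {0}))
  have hE : ∀ k, P (E k) = P {ω | ∑ i ∈ Finset.range k, ξ i ω = 0} * avoidProb P ξ n := by
    intro k
    rw [measure_past_future hm hi hid k (hB k) (measurableSet_avoidSet n), avoidProb]
    simp only [Set.mem_ofPred_eq, Finset.sum_range]
  have hEm : ∀ k, MeasurableSet (E k) := fun k =>
    ((measurable_pi_lambda _ fun i => hm _) (hB k)).inter
      ((measurable_pi_lambda _ fun i => hm _) (measurableSet_avoidSet n))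
  have hlt : ∀ k l, k < l → l < n + 1 → Disjoint (E k) (E l) := by
    intro k l hkl hl
    rw [Set.disjoint_left]
    rintro ω ⟨h1, h2⟩ ⟨h3, -⟩
    simp only [Set.mem_ofPred_eq] at h1 h3
    have h4 := h2 (l - k) (by omega) (by omega)
    rw [← Finset.sum_range (fun i => ξ i ω)] at h1 h3
    apply h4
    rw [show l = k + (l - k) by omega, Finset.sum_range_add, h1, zero_add] at h3
    exact h3
  rw [Finset.sum_mul, ← Finset.sum_congr rfl fun k _ => hE k,
    ← measure_biUnion_finset ?_ fun k _ => hEm k]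
  · exact prob_le_one
  · intro k hk l hl hne
    simp only [Finset.coe_range, Set.mem_Iio] at hk hl
    rcases lt_or_gt_of_ne hne with h | h
    · exact hlt k l h hl
    · exact (hlt l k h hk).symm

/-- The event that the random walk with increments `ξ` has not come back to the origin up to time
`n`, after having left it. -/
def noReturn (ξ : ℕ → Ω → S) (n : ℕ) : Set Ω :=
  {ω | ∀ i j, 0 < i → i < j → j ≤ n → ∑ l ∈ Finset.range i, ξ l ω ≠ 0 →
    ∑ l ∈ Finset.range j, ξ l ω ≠ 0}

lemma measurableSet_noReturn (hm : ∀ i, Measurable (ξ i)) (n : ℕ) :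
    MeasurableSet (noReturn ξ n) := by
  have hs : ∀ i, MeasurableSet {ω | ∑ l ∈ Finset.range i, ξ l ω ≠ 0} := fun i =>
    (Finset.measurable_sum (Finset.range i) fun l _ => hm l)
      (MeasurableSet.of_discrete (s := {0}ᶜ))
  have : noReturn ξ n = ⋂ (i : ℕ) (j : ℕ) (_ : 0 < i) (_ : i < j) (_ : j ≤ n),
      ({ω | ∑ l ∈ Finset.range i, ξ l ω ≠ 0}ᶜ ∪ {ω | ∑ l ∈ Finset.range j, ξ l ω ≠ 0}) := by
    ext ω
    simp only [noReturn, Set.mem_iInter, Set.mem_ofPred_eq, Set.mem_union, Set.mem_compl_iff,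
      imp_iff_not_or (a := ∑ l ∈ Finset.range _, ξ l ω ≠ 0)]
  rw [this]
  exact MeasurableSet.iInter fun i => MeasurableSet.iInter fun j => MeasurableSet.iInter fun _ =>
    MeasurableSet.iInter fun _ => MeasurableSet.iInter fun _ => (hs i).compl.union (hs j)

/-- Split at the first nonzero increment, after `k` zero ones: a walk that does not return then
avoids the origin on the remaining `n - k` steps, independently of the first `k`. -/
lemma measure_noReturn_le (hm : ∀ i, Measurable (ξ i)) (hi : iIndepFun ξ P)
    (hid : ∀ i, IdentDistrib (ξ i) (ξ 0) P P) (n : ℕ) :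
    P (noReturn ξ n) ≤
      ∑ km ∈ Finset.HasAntidiagonal.antidiagonal n, P {ω | ξ 0 ω = 0} ^ km.1 * avoidProb P ξ km.2 := by
  have hB : ∀ k, MeasurableSet {x : Fin k → S | ∀ i, x i = 0} := fun k => by
    have : {x : Fin k → S | ∀ i, x i = 0} = ⋂ i, (fun x => x i) ⁻¹' {0} := by ext; simp
    rw [this]
    exact MeasurableSet.iInter fun i => measurable_pi_apply i MeasurableSet.of_discrete
  have hsub : noReturn ξ n ⊆ ⋃ km ∈ Finset.HasAntidiagonal.antidiagonal n,
      {ω | (fun i : Fin km.1 => ξ i ω) ∈ {x : Fin km.1 → S | ∀ i, x i = 0} ∧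
        (fun i : ℕ => ξ (km.1 + i) ω) ∈ avoidSet S km.2} := by
    classical
    intro ω hω
    simp only [Set.mem_iUnion]
    by_cases hall : ∀ i < n, ξ i ω = 0
    -- The walk has not moved by time `n`; avoidance over zero steps is vacuous.
    · refine ⟨(n, 0), by simp, fun i => hall i i.2, fun j hj hj' => ?_⟩
      simp only at hj'
      omega
    · push Not at hall
      have hk := Nat.find_spec hall
      set k := Nat.find hall with hkdef
      have hz : ∀ i < k, ξ i ω = 0 := fun i hik => by
        by_contra hne
        exact Nat.find_min hall hik ⟨by omega, hne⟩
      have hz' : ∑ l ∈ Finset.range k, ξ l ω = 0 :=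
        Finset.sum_eq_zero fun i hi => hz i (Finset.mem_range.1 hi)
      have hk1 : ∑ l ∈ Finset.range (k + 1), ξ l ω ≠ 0 := by
        rw [Finset.sum_range_succ, hz', zero_add]
        exact hk.2
      refine ⟨(k, n - k), by simp; omega, fun i => hz i i.2, fun j hj hj' => ?_⟩
      have hsum : ∑ i ∈ Finset.range j, ξ (k + i) ω = ∑ l ∈ Finset.range (k + j), ξ l ω := by
        rw [Finset.sum_range_add, hz', zero_add]
      simp only at hj' ⊢
      rw [hsum]
      rcases eq_or_ne j 1 with rfl | hj1
      · exact hk1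
      · exact hω (k + 1) (k + j) (by omega) (by omega) (by omega) hk1
  refine (measure_mono hsub).trans ((measure_biUnion_finset_le _ _).trans ?_)
  refine Finset.sum_le_sum fun km _ => ?_
  rw [measure_past_future hm hi hid km.1 (hB _) (measurableSet_avoidSet _)]
  simp only [Set.mem_ofPred_eq]
  rw [measure_zero_prefix hi hid]
  rfl

/-- If the return probabilities of a random walk are at least of order `n ^ (-a)` with `a < 1`, then
the time of its first return to the origin has moments of all orders less than `1 - a`. -/
lemma tsum_measure_noReturn_lt_top (hm : ∀ i, Measurable (ξ i)) (hi : iIndepFun ξ P)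
    (hid : ∀ i, IdentDistrib (ξ i) (ξ 0) P P) (hq : P {ω | ξ 0 ω = 0} < 1)
    {a c ζ : ℝ} (ha : 0 ≤ a) (hc : 0 < c) (hζ : ζ + a < 1)
    (hp : ∀ k : ℕ, ENNReal.ofReal (c * ((k : ℝ) + 1) ^ (-a)) ≤
      P {ω | ∑ i ∈ Finset.range k, ξ i ω = 0}) :
    ∑' n : ℕ, ENNReal.ofReal (((n : ℝ) + 1) ^ (ζ - 1)) * P (noReturn ξ n) < ∞ := by
  set w : ℕ → ℝ≥0∞ := fun n => ENNReal.ofReal (((n : ℝ) + 1) ^ (ζ - 1)) with hw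
  set q := P {ω | ξ 0 ω = 0}
  have hr : ∀ n : ℕ, avoidProb P ξ n ≤ ENNReal.ofReal (c⁻¹ * ((n : ℝ) + 1) ^ (a - 1)) := by
    intro n
    have h1 := sum_mul_avoidProb_le_one hm hi hid n
    have hpos : (0 : ℝ) < (n : ℝ) + 1 := by positivity
    have h2 : ENNReal.ofReal (c * ((n : ℝ) + 1) ^ (1 - a)) ≤
        ∑ k ∈ Finset.range (n + 1), P {ω | ∑ i ∈ Finset.range k, ξ i ω = 0} := by
      calc ENNReal.ofReal (c * ((n : ℝ) + 1) ^ (1 - a))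
          = ∑ k ∈ Finset.range (n + 1), ENNReal.ofReal (c * ((n : ℝ) + 1) ^ (-a)) := by
            rw [Finset.sum_const, Finset.card_range, nsmul_eq_mul,
              ← ENNReal.ofReal_natCast, ← ENNReal.ofReal_mul (by positivity)]
            congr 1
            rw [sub_eq_add_neg, Real.rpow_add hpos, Real.rpow_one]
            push_cast
            ring
        _ ≤ _ := Finset.sum_le_sum fun k hk => by
            refine le_trans (ENNReal.ofReal_le_ofReal ?_) (hp k)
            refine mul_le_mul_of_nonneg_left ?_ hc.le
            have hk' : (k : ℝ) ≤ n := by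
              exact_mod_cast Nat.lt_succ_iff.1 (Finset.mem_range.1 hk)
            exact Real.rpow_le_rpow_of_nonpos (by positivity) (by linarith) (by linarith)
    have h3 : ENNReal.ofReal (c * ((n : ℝ) + 1) ^ (1 - a)) * avoidProb P ξ n ≤ 1 :=
      (mul_le_mul_left h2 _).trans h1
    have h4 : avoidProb P ξ n ≤ (ENNReal.ofReal (c * ((n : ℝ) + 1) ^ (1 - a)))⁻¹ := by
      rw [ENNReal.le_inv_iff_mul_le, mul_comm]
      exact h3
    refine h4.trans_eq ?_
    rw [← ENNReal.ofReal_inv_of_pos (by positivity), mul_inv, ← Real.rpow_neg hpos.le, neg_sub]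
  -- Since `ζ ≤ 1` the weights decrease, so the delay `k` can be dropped from them and the double
  -- sum factorizes.
  have hanti : ∀ k m : ℕ, w (k + m) ≤ w m := fun k m => by
    refine ENNReal.ofReal_le_ofReal ?_
    refine Real.rpow_le_rpow_of_nonpos (by positivity) ?_ (by linarith)
    push_cast
    linarith [(Nat.cast_nonneg k : (0 : ℝ) ≤ k)]
  have hsum : ∑' m, w m * avoidProb P ξ m < ∞ := by
    have hle : ∀ m : ℕ, w m * avoidProb P ξ m ≤
        ENNReal.ofReal (c⁻¹ * ((m : ℝ) + 1) ^ (ζ + a - 2)) := fun m => by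
      have hpos : (0 : ℝ) < (m : ℝ) + 1 := by positivity
      refine (mul_le_mul_right (hr m) _).trans_eq ?_
      rw [hw, ← ENNReal.ofReal_mul (by positivity), mul_left_comm, ← Real.rpow_add hpos]
      ring_nf
    refine (ENNReal.tsum_le_tsum hle).trans_lt ?_
    have hs : Summable fun m : ℕ => c⁻¹ * ((m : ℝ) + 1) ^ (ζ + a - 2) := by
      refine Summable.mul_left _ ?_
      have := (summable_nat_add_iff 1).2 (Real.summable_nat_rpow.2 (by linarith : ζ + a - 2 < -1))
      simpa using this
    rw [← ENNReal.ofReal_tsum_of_nonneg (fun m => by positivity) hs]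
    exact ENNReal.ofReal_lt_top
  calc ∑' n : ℕ, w n * P (noReturn ξ n)
      ≤ ∑' n : ℕ, ∑ km : Finset.HasAntidiagonal.antidiagonal n,
          q ^ km.1.1 * (w km.1.2 * avoidProb P ξ km.1.2) := by
        refine ENNReal.tsum_le_tsum fun n => ?_
        rw [Finset.sum_coe_sort (Finset.HasAntidiagonal.antidiagonal n)
          (fun km => q ^ km.1 * (w km.2 * avoidProb P ξ km.2))]
        refine (mul_le_mul_right (measure_noReturn_le hm hi hid n) _).trans ?_
        rw [Finset.mul_sum]
        refine Finset.sum_le_sum fun km hkm => ?_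
        rw [mul_left_comm]
        rw [← Finset.HasAntidiagonal.mem_antidiagonal.1 hkm]
        gcongr
        exact hanti _ _
    _ = ∑' km : ℕ × ℕ, q ^ km.1 * (w km.2 * avoidProb P ξ km.2) := by
        rw [← Finset.HasAntidiagonal.sigmaAntidiagonalEquivProd.tsum_eq
          (fun km : ℕ × ℕ => q ^ km.1 * (w km.2 * avoidProb P ξ km.2)), ENNReal.tsum_sigma']
        simp only [tsum_fintype]
        rfl
    _ = (∑' k : ℕ, q ^ k) * ∑' m, w m * avoidProb P ξ m := by
        rw [ENNReal.tsum_prod', ← ENNReal.tsum_mul_right]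
        simp only [ENNReal.tsum_mul_left]
    _ < ∞ := by
        refine ENNReal.mul_lt_top ?_ hsum
        rw [ENNReal.tsum_geometric, ENNReal.inv_lt_top]
        exact tsub_pos_of_lt hq

end RandomWalk

end LevyWalk

namespace LevyWalk

/-! ### Return time of the process and its skeleton. -/

section LevyProcess

variable {S Ω : Type*} [AddCommGroup S] {X : ℝ≥0 → Ω → S}

/-- An infimum over the set of times at which a locally right-constant event happens can be taken
over a countable dense set of times. -/
lemma iInf_eq_iInf_denseSeq {p : ℝ≥0 → Prop}
    (hp : ∀ t, p t → ∀ᶠ s in 𝓝[>] t, p s) :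
    (⨅ (t : ℝ≥0) (_ : p t), (t : ℝ≥0∞)) =
      ⨅ (n : ℕ) (_ : p (TopologicalSpace.denseSeq ℝ≥0 n)),
        (TopologicalSpace.denseSeq ℝ≥0 n : ℝ≥0∞) := by
  refine le_antisymm (le_iInf₂ fun n hn => iInf₂_le _ hn) (le_iInf₂ fun t ht => ?_)
  refine le_of_forall_gt fun b hb => ?_
  have h1 : ∀ᶠ s in 𝓝[>] t, p s ∧ (s : ℝ≥0∞) < b :=
    (hp t ht).and (nhdsWithin_le_nhds
      (ENNReal.continuous_coe.continuousAt.eventually (gt_mem_nhds hb)))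
  obtain ⟨u, hu, hsub⟩ := (mem_nhdsGT_iff_exists_Ioo_subset).1 h1
  obtain ⟨n, hn⟩ := (TopologicalSpace.denseRange_denseSeq ℝ≥0).exists_mem_open isOpen_Ioo
    (Set.nonempty_Ioo.2 hu)
  have h2 := hsub hn
  exact (iInf₂_le (f := fun (n : ℕ) (_ : p (TopologicalSpace.denseSeq ℝ≥0 n)) =>
    (TopologicalSpace.denseSeq ℝ≥0 n : ℝ≥0∞)) n h2.1).trans_lt h2.2

lemma eventually_eq_of_continuousWithinAt {S : Type*} [TopologicalSpace S]
    [DiscreteTopology S] {f : ℝ≥0 → S} {t : ℝ≥0}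
    (h : ContinuousWithinAt f (Set.Ici t) t) : ∀ᶠ s in 𝓝[>] t, f s = f t := by
  have h1 := h.mono_left (nhdsWithin_mono t Set.Ioi_subset_Ici_self)
  rw [nhds_discrete, tendsto_pure] at h1
  exact h1

lemma rpow_le_sum_rpow (N : ℕ) {ζ : ℝ} (hζ0 : 0 < ζ) (hζ1 : ζ ≤ 1) :
    ENNReal.ofReal ((N : ℝ) ^ ζ) ≤
      ∑ n ∈ Finset.range N, ENNReal.ofReal (((n : ℝ) + 1) ^ (ζ - 1)) := by
  rcases Nat.eq_zero_or_pos N with rfl | hN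
  · simp [Real.zero_rpow hζ0.ne']
  · have hN' : (0 : ℝ) < N := by exact_mod_cast hN
    calc ENNReal.ofReal ((N : ℝ) ^ ζ)
        = ∑ n ∈ Finset.range N, ENNReal.ofReal ((N : ℝ) ^ (ζ - 1)) := by
          rw [Finset.sum_const, Finset.card_range, nsmul_eq_mul,
            ← ENNReal.ofReal_natCast, ← ENNReal.ofReal_mul (by positivity)]
          congr 1
          rw [Real.rpow_sub_one hN'.ne', mul_div_cancel₀ _ hN'.ne']
      _ ≤ _ := Finset.sum_le_sum fun n hn => ENNReal.ofReal_le_ofReal <| by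
          have h : (n : ℝ) + 1 ≤ N := by exact_mod_cast Finset.mem_range.1 hn
          exact Real.rpow_le_rpow_of_nonpos (by positivity) h (by linarith)

lemma lintegral_ofReal_inv_Ioi_eq_top {b : ℝ} (hb : 0 < b) :
    ∫⁻ t in Set.Ioi b, ENNReal.ofReal t⁻¹ = ∞ := by
  by_contra hne
  refine not_integrableOn_Ioi_inv (a := b) ⟨measurable_inv.aestronglyMeasurable, ?_⟩
  rw [hasFiniteIntegral_iff_ofReal]
  · exact lt_top_iff_ne_top.2 hne
  · filter_upwards [ae_restrict_mem measurableSet_Ioi] with t ht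
    exact inv_nonneg.2 (hb.trans ht).le

lemma holdingTime_le {ω : Ω} {t : ℝ≥0} (ht : 0 < t) (h : X t ω ≠ 0) : holdingTime X ω ≤ t :=
  iInf₂_le t ⟨ht, h⟩

lemma returnTime_le {ω : Ω} {t : ℝ≥0} (ht : holdingTime X ω < t) (h : X t ω = 0) :
    returnTime X ω ≤ t :=
  iInf₂_le t ⟨ht, h⟩

/-- The increments of the skeleton of `X` with mesh `δ`. -/
def skeletonIncr (X : ℝ≥0 → Ω → S) (δ : ℝ≥0) (i : ℕ) (ω : Ω) : S :=
  X ((i + 1 : ℕ) * δ) ω - X (i * δ) ω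

lemma sum_skeletonIncr (X : ℝ≥0 → Ω → S) (δ : ℝ≥0) (n : ℕ) (ω : Ω) :
    ∑ i ∈ Finset.range n, skeletonIncr X δ i ω = X (n * δ) ω - X 0 ω := by
  simp only [skeletonIncr]
  rw [Finset.sum_range_sub (fun i : ℕ => X (i * δ) ω)]
  simp

/-- If `N` is the first step by which the skeleton has returned, then `T ≤ δ * N`: a nonzero sample
lies at or after the holding time, and a later zero sample strictly after it. The sum of the weights
below `N` dominates `N ^ ζ`. -/
lemma returnTime_rpow_le {δ : ℝ≥0} (hδ : 0 < δ) {ζ : ℝ} (hζ0 : 0 < ζ) (hζ1 : ζ ≤ 1) {ω : Ω}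
    (h0 : X 0 ω = 0) :
    returnTime X ω ^ ζ ≤ (δ : ℝ≥0∞) ^ ζ * ∑' n : ℕ, ENNReal.ofReal (((n : ℝ) + 1) ^ (ζ - 1)) *
      (noReturn (skeletonIncr X δ) n).indicator 1 ω := by
  classical
  set w : ℕ → ℝ≥0∞ := fun n => ENNReal.ofReal (((n : ℝ) + 1) ^ (ζ - 1))
  set A := noReturn (skeletonIncr X δ)
  have hlow : ∀ N, (∀ n < N, ω ∈ A n) →
      ENNReal.ofReal ((N : ℝ) ^ ζ) ≤ ∑' n : ℕ, w n * (A n).indicator 1 ω := fun N hN => by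
    refine (rpow_le_sum_rpow N hζ0 hζ1).trans (le_trans (Finset.sum_le_sum fun n hn => ?_)
      (ENNReal.sum_le_tsum (Finset.range N)))
    rw [Set.indicator_of_mem (hN n (Finset.mem_range.1 hn)), Pi.one_apply, mul_one]
  by_cases hall : ∀ n, ω ∈ A n
  -- Without a skeleton return nothing bounds `T`, but the right side is infinite because `N ^ ζ` is
  -- unbounded.
  · have htop : ∑' n : ℕ, w n * (A n).indicator 1 ω = ∞ := by
      refine top_unique (le_of_tendsto' (x := atTop) ?_ fun N : ℕ => hlow N fun n _ => hall n)
      exact ENNReal.tendsto_ofReal_atTop.comp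
        ((tendsto_rpow_atTop hζ0).comp tendsto_natCast_atTop_atTop)
    rw [htop, ENNReal.mul_top]
    · exact le_top
    · simp [hδ.ne', hζ0.not_gt]
  · push Not at hall
    have hN := Nat.find_spec hall
    set N := Nat.find hall
    have hmin : ∀ n < N, ω ∈ A n := fun n hn => by
      by_contra hne
      exact Nat.find_min hall hn hne
    have hT : returnTime X ω ≤ (δ : ℝ≥0∞) * N := by
      simp only [A, noReturn, Set.mem_ofPred_eq, sum_skeletonIncr, h0, sub_zero] at hN
      push Not at hN
      obtain ⟨i, j, hi, hij, hjN, hne, hz⟩ := hN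
      have hi' : (0 : ℝ≥0) < i := by exact_mod_cast hi
      have hij' : (i : ℝ≥0) < j := by exact_mod_cast hij
      have hjN' : (j : ℝ≥0∞) ≤ N := by exact_mod_cast hjN
      have h1 : holdingTime X ω < ((j * δ : ℝ≥0) : ℝ≥0∞) :=
        (holdingTime_le (by positivity) hne).trans_lt
          (ENNReal.coe_lt_coe.2 (mul_lt_mul_of_pos_right hij' hδ))
      refine (returnTime_le h1 hz).trans ?_
      push_cast
      rw [mul_comm]
      gcongr
    calc returnTime X ω ^ ζ ≤ ((δ : ℝ≥0∞) * N) ^ ζ := ENNReal.rpow_le_rpow hT hζ0.le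
      _ = (δ : ℝ≥0∞) ^ ζ * ENNReal.ofReal ((N : ℝ) ^ ζ) := by
        rw [ENNReal.mul_rpow_of_nonneg _ _ hζ0.le,
          ← ENNReal.ofReal_rpow_of_nonneg (Nat.cast_nonneg N) hζ0.le, ENNReal.ofReal_natCast]
      _ ≤ _ := by
        gcongr
        exact hlow N hmin

variable [MeasurableSpace Ω] {P : Measure Ω}

lemma transProb_zero_zero (t : ℝ≥0) : transProb X P t 0 0 = P.real {ω | X t ω = 0} := by
  simp [transProb]

variable [TopologicalSpace S] [MeasurableSpace S]

lemma iIndepFun_skeletonIncr (hX : IsLevyProcess X P) (δ : ℝ≥0) :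
    iIndepFun (skeletonIncr X δ) P :=
  hX.indep.nat (t := fun i : ℕ => (i : ℝ≥0) * δ) fun i j hij => by
    dsimp only
    gcongr

lemma identDistrib_skeletonIncr (hX : IsLevyProcess X P) (δ : ℝ≥0) (i : ℕ) :
    IdentDistrib (skeletonIncr X δ i) (skeletonIncr X δ 0) P P := by
  have h : ∀ i, IdentDistrib (skeletonIncr X δ i) (fun ω => X δ ω - X 0 ω) P P := fun i => by
    have := hX.stationary (i * δ) δ
    have h1 : (i : ℝ≥0) * δ + δ = (i + 1 : ℕ) * δ := by push_cast; ring
    rwa [h1] at this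
  exact (h i).trans (h 0).symm

lemma measure_sum_skeletonIncr [IsProbabilityMeasure P] (hX : IsLevyProcess X P) (δ : ℝ≥0) (k : ℕ) :
    P {ω | ∑ i ∈ Finset.range k, skeletonIncr X δ i ω = 0} =
      ENNReal.ofReal (transProb X P (k * δ) 0 0) := by
  rw [transProb_zero_zero, ofReal_measureReal]
  refine measure_congr ?_
  filter_upwards [hX.start] with ω hω
  refine propext ?_
  change ∑ i ∈ Finset.range k, skeletonIncr X δ i ω = 0 ↔ X (k * δ) ω = 0
  rw [sum_skeletonIncr, hω, sub_zero]

variable [DiscreteMeasurableSpace S]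

lemma measurableSet_eq_zero (hX : IsLevyProcess X P) (t : ℝ≥0) :
    MeasurableSet {ω | X t ω = 0} :=
  hX.measurable t (MeasurableSet.of_discrete (s := {0}))

lemma measurable_skeletonIncr [Countable S] (hX : IsLevyProcess X P) (δ : ℝ≥0) (i : ℕ) :
    Measurable (skeletonIncr X δ i) :=
  (hX.measurable _).sub (hX.measurable _)

/-- On càdlàg paths in a discrete space, the conditions defining both infima persist on a right
neighbourhood of any time where they hold, so countably many times suffice. Only almost every path
is càdlàg, hence a.e. measurability. -/
lemma aemeasurable_returnTime [DiscreteTopology S] (hX : IsLevyProcess X P) :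
    AEMeasurable (returnTime X) P := by
  classical
  set d := TopologicalSpace.denseSeq ℝ≥0
  have hset : ∀ n, MeasurableSet {ω | X (d n) ω = 0} := fun n =>
    hX.measurable _ (MeasurableSet.of_discrete (s := {0}))
  have hcond : ∀ (c : ℝ≥0∞) (p : Ω → Prop), MeasurableSet {ω | p ω} →
      Measurable fun ω => ⨅ (_ : p ω), c := fun c p hmp => by
    have : (fun ω => ⨅ (_ : p ω), c) = fun ω => if p ω then c else ⊤ := by
      funext ω
      split_ifs with h <;> simp [h]
    rw [this]
    exact Measurable.ite hmp measurable_const measurable_const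
  let h : Ω → ℝ≥0∞ := fun ω => ⨅ (n : ℕ) (_ : 0 < d n ∧ X (d n) ω ≠ 0), (d n : ℝ≥0∞)
  have hh : Measurable h := Measurable.iInf fun n =>
    hcond _ _ ((MeasurableSet.const _).inter (hset n).compl)
  refine ⟨fun ω => ⨅ (n : ℕ) (_ : h ω < d n ∧ X (d n) ω = 0), (d n : ℝ≥0∞),
    Measurable.iInf fun n => hcond _ _ ((measurableSet_lt hh measurable_const).inter (hset n)), ?_⟩
  filter_upwards [hX.cadlag] with ω hω
  have hright : ∀ t : ℝ≥0, ∀ᶠ s in 𝓝[>] t, X s ω = X t ω := fun t =>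
    eventually_eq_of_continuousWithinAt (hω t).1
  have hH : holdingTime X ω = h ω := by
    refine iInf_eq_iInf_denseSeq (p := fun t => 0 < t ∧ X t ω ≠ 0) fun t ht => ?_
    filter_upwards [hright t, self_mem_nhdsWithin] with s hs hts
    exact ⟨ht.1.trans hts, hs ▸ ht.2⟩
  rw [returnTime, hH]
  refine iInf_eq_iInf_denseSeq (p := fun t => h ω < t ∧ X t ω = 0) fun t ht => ?_
  filter_upwards [hright t, self_mem_nhdsWithin] with s hs hts
  exact ⟨ht.1.trans (ENNReal.coe_lt_coe.2 hts), hs ▸ ht.2⟩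

/-! ### Lower bounds on transition probabilities, and their consequences. -/

variable [IsProbabilityMeasure P]

lemma transProb_mul_le (hX : IsLevyProcess X P) (s t : ℝ≥0) :
    transProb X P s 0 0 * transProb X P t 0 0 ≤ transProb X P (s + t) 0 0 := by
  simp only [transProb_zero_zero]
  have hind := hX.indep.indepFun_eval_sub zero_le (le_self_add (a := s) (b := t)) hX.start
  have h1 := hind.measure_inter_preimage_eq_mul {0} {0} MeasurableSet.of_discrete
    MeasurableSet.of_discrete
  have h2 : P ((X (s + t) - X s) ⁻¹' {0}) = P {ω | X t ω = 0} := by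
    refine ((hX.stationary s t).measure_mem_eq (MeasurableSet.of_discrete (s := {0}))).trans ?_
    refine measure_congr ?_
    filter_upwards [hX.start] with ω hω
    refine propext ?_
    change X t ω - X 0 ω = 0 ↔ X t ω = 0
    rw [hω, sub_zero]
  rw [h2] at h1
  rw [measureReal_def, measureReal_def, ← ENNReal.toReal_mul]
  refine ENNReal.toReal_mono (measure_ne_top _ _) ?_
  refine h1.symm.trans_le (measure_mono ?_)
  rintro ω ⟨ha, hb⟩
  simp only [Set.mem_preimage, Set.mem_singleton_iff, Pi.sub_apply] at ha hb
  change X (s + t) ω = 0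
  rwa [ha, sub_zero] at hb

lemma transProb_zero_eq_one (hX : IsLevyProcess X P) : transProb X P 0 0 0 = 1 := by
  rw [transProb_zero_zero, measureReal_def,
    (mem_ae_iff_prob_eq_one (measurableSet_eq_zero hX 0)).1 hX.start, ENNReal.toReal_one]

lemma exists_transProb_lt_one [Nontrivial S] (hX : IsLevyProcess X P) (hirr : IsIrreducible X P) :
    ∃ t : ℝ≥0, 0 < t ∧ transProb X P t 0 0 < 1 := by
  obtain ⟨y, hy⟩ := exists_ne (0 : S)
  obtain ⟨t, ht, h⟩ := hirr 0 y
  refine ⟨t, ht, ?_⟩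
  by_contra! hcon
  have h1 : P {ω | X t ω = 0} = 1 := by
    rw [transProb_zero_zero] at hcon
    have h2 := le_antisymm measureReal_le_one hcon
    rwa [measureReal_def, ENNReal.toReal_eq_one_iff] at h2
  have h2 : ∀ᵐ ω ∂P, X t ω = 0 :=
    (mem_ae_iff_prob_eq_one (measurableSet_eq_zero hX t)).2 h1
  have h3 : transProb X P t 0 y = 0 := by
    rw [transProb, measureReal_eq_zero_iff, measure_eq_zero_iff_ae_notMem]
    filter_upwards [h2] with ω hω
    simp only [hω, add_zero]
    exact hy.symm
  exact h.ne' h3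

lemma transProb_pow_le (hX : IsLevyProcess X P) (t : ℝ≥0) (n : ℕ) :
    transProb X P t 0 0 ^ n ≤ transProb X P (n * t) 0 0 := by
  induction n with
  | zero => simp [transProb_zero_eq_one hX]
  | succ n ih =>
    rw [pow_succ]
    refine (mul_le_mul_of_nonneg_right ih measureReal_nonneg).trans ?_
    refine (transProb_mul_le hX _ _).trans_eq ?_
    push_cast
    ring_nf

variable [DiscreteTopology S]

/-- Right continuity at time zero makes short returns likely, and hence all returns possible. -/
lemma transProb_pos (hX : IsLevyProcess X P) (t : ℝ≥0) : 0 < transProb X P t 0 0 := by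
  have hu : Tendsto (fun n : ℕ => t / ((n : ℝ≥0) + 1)) atTop (𝓝 0) := by
    have := (tendsto_const_div_atTop_nhds_zero_nat (t : ℝ)).comp (tendsto_add_atTop_nat 1)
    rw [← NNReal.tendsto_coe]
    simpa [Function.comp_def] using this
  have hex : ∃ n : ℕ, 0 < transProb X P (t / ((n : ℝ≥0) + 1)) 0 0 := by
    by_contra! hcon
    have h0 : ∀ n : ℕ, ∀ᵐ ω ∂P, X (t / ((n : ℝ≥0) + 1)) ω ≠ 0 := fun n => by
      have := le_antisymm (hcon n) measureReal_nonneg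
      rw [transProb_zero_zero, measureReal_eq_zero_iff] at this
      simpa [ae_iff] using this
    obtain ⟨ω, h1, h2, h3⟩ := ((ae_all_iff.2 h0).and (hX.start.and hX.cadlag)).exists
    have h4 := (h3 0).1
    rw [ContinuousWithinAt, nhds_discrete, tendsto_pure, h2] at h4
    have h5 : Tendsto (fun n : ℕ => t / ((n : ℝ≥0) + 1)) atTop (𝓝[Set.Ici 0] 0) :=
      tendsto_nhdsWithin_iff.2 ⟨hu, Eventually.of_forall fun n => Set.mem_Ici.2 zero_le⟩
    obtain ⟨n, hn⟩ := (h5.eventually h4).exists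
    exact h1 n hn
  obtain ⟨n, hn⟩ := hex
  refine (pow_pos hn (n + 1)).trans_le ((transProb_pow_le hX _ _).trans_eq ?_)
  have : ((n : ℝ≥0) + 1) ≠ 0 := by positivity
  push_cast
  rw [mul_div_cancel₀ _ this]

/-- The polynomial lower bound on the transition probabilities. -/
lemma eventually_rpow_le_transProb (hX : IsLevyProcess X P) {a : ℝ}
    (hp : (fun t : ℝ≥0 => (transProb X P t 0 0)⁻¹) =o[atTop] (fun t : ℝ≥0 => (t : ℝ) ^ a)) :
    ∀ᶠ t : ℝ≥0 in atTop, (t : ℝ) ^ (-a) ≤ transProb X P t 0 0 := by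
  filter_upwards [hp.bound one_pos] with t ht
  have hpos := transProb_pos hX t
  rw [one_mul, Real.norm_of_nonneg (by positivity), Real.norm_of_nonneg (by positivity)] at ht
  rw [Real.rpow_neg (NNReal.coe_nonneg t)]
  exact inv_le_of_inv_le₀ hpos ht

lemma exists_skeleton_lower_bound (hX : IsLevyProcess X P) {a : ℝ} (ha : 0 ≤ a)
    (hp : (fun t : ℝ≥0 => (transProb X P t 0 0)⁻¹) =o[atTop] (fun t : ℝ≥0 => (t : ℝ) ^ a))
    {δ : ℝ≥0} (hδ : 0 < δ) :
    ∃ c : ℝ, 0 < c ∧ ∀ k : ℕ, c * ((k : ℝ) + 1) ^ (-a) ≤ transProb X P (k * δ) 0 0 := by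
  have hlim : Tendsto (fun k : ℕ => (k : ℝ≥0) * δ) atTop atTop :=
    tendsto_natCast_atTop_atTop.atTop_mul_const hδ
  obtain ⟨N, hN⟩ := eventually_atTop.1 (hlim.eventually (eventually_rpow_le_transProb hX hp))
  obtain ⟨k₀, -, hk₀⟩ := (Finset.range (N + 1)).exists_min_image
    (fun k : ℕ => transProb X P (k * δ) 0 0) ⟨0, by simp⟩
  have hδ' : (0 : ℝ) < δ := hδ
  -- The first term covers the finitely many `k ≤ N`, by positivity of the return probabilities; the
  -- second comes from the asymptotic bound at time `k * δ`.
  refine ⟨min (transProb X P (k₀ * δ) 0 0) ((δ : ℝ) ^ (-a)),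
    lt_min (transProb_pos hX _) (by positivity), fun k => ?_⟩
  rcases Nat.lt_or_ge k (N + 1) with hk | hk
  · calc _ ≤ transProb X P (k₀ * δ) 0 0 * 1 := by
          refine mul_le_mul (min_le_left _ _) ?_ (by positivity) measureReal_nonneg
          exact Real.rpow_le_one_of_one_le_of_nonpos
            (by linarith [(Nat.cast_nonneg k : (0 : ℝ) ≤ k)]) (by linarith)
      _ ≤ _ := by rw [mul_one]; exact hk₀ k (Finset.mem_range.2 hk)
  · have hk0 : (0 : ℝ) < k := by exact_mod_cast (by omega : 0 < k)
    calc _ ≤ (δ : ℝ) ^ (-a) * (k : ℝ) ^ (-a) := by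
          refine mul_le_mul (min_le_right _ _) ?_ (by positivity) (by positivity)
          exact Real.rpow_le_rpow_of_nonpos hk0 (by linarith) (by linarith)
      _ = ((k * δ : ℝ≥0) : ℝ) ^ (-a) := by
          push_cast
          rw [Real.mul_rpow hk0.le hδ'.le, mul_comm]
      _ ≤ _ := hN k (by omega)

theorem lintegral_returnTime_rpow_lt_top [Countable S] [Nontrivial S] (hX : IsLevyProcess X P)
    (hirr : IsIrreducible X P) {a ζ : ℝ} (ha : 0 ≤ a) (hζ0 : 0 < ζ) (hζ : ζ + a < 1)
    (hp : (fun t : ℝ≥0 => (transProb X P t 0 0)⁻¹) =o[atTop] (fun t : ℝ≥0 => (t : ℝ) ^ a)) :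
    ∫⁻ ω, returnTime X ω ^ ζ ∂P < ∞ := by
  -- With this mesh the skeleton leaves the origin with positive probability in each step, so the
  -- geometric series of delays converges.
  obtain ⟨δ, hδ, hδ1⟩ := exists_transProb_lt_one hX hirr
  obtain ⟨c, hc, hck⟩ := exists_skeleton_lower_bound hX ha hp hδ
  have hm := measurable_skeletonIncr hX δ
  have hq : P {ω | skeletonIncr X δ 0 ω = 0} < 1 := by
    have := measure_sum_skeletonIncr hX δ 1
    simp only [Finset.sum_range_one, Nat.cast_one, one_mul] at this
    rw [this]
    exact ENNReal.ofReal_lt_one.2 hδ1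
  have hfin := tsum_measure_noReturn_lt_top hm (iIndepFun_skeletonIncr hX δ)
    (identDistrib_skeletonIncr hX δ) hq ha hc hζ fun k => by
      rw [measure_sum_skeletonIncr hX]
      exact ENNReal.ofReal_le_ofReal (hck k)
  have hA := measurableSet_noReturn hm
  have hmeas : ∀ n : ℕ, Measurable fun ω => ENNReal.ofReal (((n : ℝ) + 1) ^ (ζ - 1)) *
      (noReturn (skeletonIncr X δ) n).indicator (1 : Ω → ℝ≥0∞) ω := fun n =>
    (measurable_one.indicator (hA n)).const_mul _
  calc ∫⁻ ω, returnTime X ω ^ ζ ∂P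
      ≤ ∫⁻ ω, (δ : ℝ≥0∞) ^ ζ * ∑' n : ℕ, ENNReal.ofReal (((n : ℝ) + 1) ^ (ζ - 1)) *
          (noReturn (skeletonIncr X δ) n).indicator 1 ω ∂P :=
        lintegral_mono_ae <| hX.start.mono fun ω h0 =>
          returnTime_rpow_le hδ hζ0 (by linarith) h0
    _ = (δ : ℝ≥0∞) ^ ζ * ∑' n : ℕ, ENNReal.ofReal (((n : ℝ) + 1) ^ (ζ - 1)) *
          P (noReturn (skeletonIncr X δ) n) := by
        rw [lintegral_const_mul _ (Measurable.tsum hmeas),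
          lintegral_tsum fun n => (hmeas n).aemeasurable]
        congr 2
        funext n
        rw [lintegral_const_mul _ (measurable_one.indicator (hA n)), lintegral_indicator_one (hA n)]
    _ < ∞ := ENNReal.mul_lt_top
        (ENNReal.rpow_lt_top_of_nonneg hζ0.le ENNReal.coe_ne_top) hfin

/-- The Green operator of order `a` of the indicator of the origin is infinite. -/
lemma greenPower_single_eq_top (hX : IsLevyProcess X P) [DecidableEq S] {a : ℝ} (ha : 0 < a)
    (hp : (fun t : ℝ≥0 => (transProb X P t 0 0)⁻¹) =o[atTop] (fun t : ℝ≥0 => (t : ℝ) ^ a)) :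
    greenPower X P a (Pi.single 0 1) 0 = ∞ := by
  have hsemi : ∀ t : ℝ≥0, semigroup X P t (Pi.single 0 1) 0 =
      ENNReal.ofReal (transProb X P t 0 0) := fun t => by
    rw [transProb_zero_zero, ofReal_measureReal, semigroup,
      ← lintegral_indicator_one (measurableSet_eq_zero hX t)]
    refine lintegral_congr fun ω => ?_
    by_cases h : X t ω = 0 <;> simp [h]
  obtain ⟨t₀, ht₀⟩ := eventually_atTop.1 (eventually_rpow_le_transProb hX hp)
  rw [greenPower, ENNReal.mul_eq_top]
  refine Or.inl ⟨by simpa using Real.Gamma_pos_of_pos ha, top_unique ?_⟩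
  -- Adding `1` keeps the cutoff positive even if `t₀ = 0`.
  have hb : (0 : ℝ) < t₀ + 1 := by positivity
  rw [← lintegral_ofReal_inv_Ioi_eq_top hb]
  refine le_trans (setLIntegral_mono_ae' measurableSet_Ioi (Eventually.of_forall fun t ht => ?_))
    (lintegral_mono_set (Set.Ioi_subset_Ioi hb.le))
  have ht0 : 0 < t := hb.trans ht
  have htr : t₀ ≤ t.toNNReal := by
    rw [Set.mem_Ioi] at ht
    rw [Real.le_toNNReal_iff_coe_le ht0.le]
    linarith
  rw [hsemi, ← ENNReal.ofReal_mul (by positivity)]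
  refine ENNReal.ofReal_le_ofReal ?_
  have h := ht₀ _ htr
  rw [Real.coe_toNNReal t ht0.le] at h
  calc t⁻¹ = t ^ (a - 1) * t ^ (-a) := by
        rw [← Real.rpow_add ht0, ← Real.rpow_neg_one]
        ring_nf
    _ ≤ _ := mul_le_mul_of_nonneg_left h (by positivity)

end LevyProcess

end LevyWalk

theorem mainTheorem8 {S Ω : Type*} [AddCommGroup S] [Countable S] [Nontrivial S]
    [MetricSpace S] [DiscreteTopology S] [MeasurableSpace S] [BorelSpace S] [MeasurableSpace Ω]
    (P : Measure Ω) [IsProbabilityMeasure P] (X : ℝ≥0 → Ω → S)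
    (hX : LevyWalk.IsLevyProcess X P) (hirr : LevyWalk.IsIrreducible X P)
    (μ : ℝ) (hμ0 : 0 < μ) (hμ1 : μ < 1)
    (hp : ∀ ε : ℝ, 0 < ε →
      (fun t : ℝ≥0 => (LevyWalk.transProb X P t 0 0)⁻¹) =o[atTop]
        (fun t : ℝ≥0 => (t : ℝ) ^ (μ + ε))) :
    LevyWalk.degree X P ≤ ((μ - 1 : ℝ) : EReal) ∧
    AEMeasurable (LevyWalk.returnTime X) P ∧
    ∀ ζ : ℝ, 0 < ζ → ζ < 1 - μ → ∫⁻ ω, LevyWalk.returnTime X ω ^ ζ ∂P < ∞ := by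
  classical
  have : DiscreteMeasurableSpace S := ⟨fun s => (isOpen_discrete s).measurableSet⟩
  refine ⟨?_, LevyWalk.aemeasurable_returnTime hX, fun ζ hζ0 hζ1 => ?_⟩
  · refine sSup_le ?_
    rintro _ ⟨ζ, ⟨hζ, hfin⟩, rfl⟩
    rw [EReal.coe_le_coe_iff]
    by_contra! hlt
    refine (hfin (Pi.single 0 1) Measurable.of_discrete ?_ ?_ 0).ne
      (LevyWalk.greenPower_single_eq_top hX (by linarith) ?_)
    · refine ⟨1, ?_⟩
      rintro _ ⟨x, rfl⟩
      by_cases h : x = 0 <;> simp [h]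
    · exact Bornology.isBounded_singleton.subset Pi.support_single_subset
    -- This `ε` makes `μ + ε` equal to the order `ζ + 1` of the Green power.
    · have := hp (ζ + 1 - μ) (by linarith)
      rwa [show μ + (ζ + 1 - μ) = ζ + 1 by ring] at this
  -- The exponent `a` is the midpoint of `μ` and `1 - ζ`, so that both `a > μ` and `ζ + a < 1`.
  · exact LevyWalk.lintegral_returnTime_rpow_lt_top hX hirr
      (a := μ + (1 - μ - ζ) / 2) (by linarith) hζ0 (by linarith) (hp _ (by linarith))
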